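/- **Theorem** (Khoussainov, Rubin, Stephan; 2003). If $\mathcal T=(T;\le)$ is a word-automatic partial-order tree, then its Cantor–Bendixson rank $CB(\mathcal T)$ is finite. Here a *(partial-order) tree* is a partial order $(T;\le)$ with a least element in which, for every $x\in T$, the set of $\le$-predecessors of $x$ is finite and linearly ordered. It is not assumed to be finitely branching or to have only countably many infinite paths. The *convolution* of words $x_1,\dots,x_k\in\Sigma^\star$ over a finite alphabet $\Sigma$ is the word over $(\Sigma\cup\{\Diamond\})^k$ obtained by padding the $x_i$ at the end with a new symbol $\Diamond$ to the length of the longest of them and reading them in parallel. A $k$-ary relation on $\Sigma^\star$ is *regular* if the set of convolutions of its elements is a regular language. The structure $(T;\le)$ is *word-automatic* if, up to isomorphism, $T\subseteq\Sigma^\star$ is a regular language for some finite alphabet $\Sigma$ and $\le$ is a regular relation on $\Sigma^\star$. For a set $S\subseteq T$, an *infinite path* of $S$ is an infinite, linearly ordered subset of $S$ that contains with each of its elements all predecessors of that element in $S$. The *derivative* $d(S)$ is the set of all $x$ that belong to two distinct infinite paths of $S$. Put $d^0(\mathcal T)=T$, $d^{\alpha+1}(\mathcal T)=d(d^\alpha(\mathcal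 T))$, and $d^\gamma(\mathcal T)=\bigcap_{\beta<\gamma}d^\beta(\mathcal T)$ for limit ordinals $\gamma$. The *Cantor–Bendixson rank* $CB(\mathcal T)$ is the least ordinal $\alpha$ with $d^\alpha(\mathcal T)=d^{\alpha+1}(\mathcal T)$. -/

import Mathlib

/-! ### Regular relations on words and word-automatic orders -/

namespace WordAutomatic

/-- The convolution of a `k`-tuple of words: the word, as long as the longest component, whose
`j`-th letter is the tuple of the `j`-th letters of the components; `none` is the padding symbol,
used at the positions after the end of a component. -/
def convolution {A : Type*} {k : ℕ} (w : Fin k → List A) : List (Fin k → Option A) :=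
  (List.range (Finset.univ.sup fun i => (w i).length)).map fun j i => (w i)[j]?

/-- A `k`-ary relation on words is regular if the set of convolutions of its elements is a regular
language (over the alphabet of `k`-tuples of letters or padding symbols). -/
def IsRegularRel {A : Type*} {k : ℕ} (R : Set (Fin k → List A)) : Prop :=
  Language.IsRegular (T := Fin k → Option A) (convolution '' R)

/-- `ρ` names the elements of `T` by words over `A` in such a way that `(T; ≤)` becomes a
word-automatic structure: its domain, the set of names, is a regular language, and its relation
`≤` is a regular relation on words. If `T` is itself a set of words and `ρ` the inclusion, this says
that the structure `(T; ≤)` is word automatic. -/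
structure IsPresentation {A T : Type*} [LE T] (ρ : T → List A) : Prop where
  injective : Function.Injective ρ
  domain_regular : Language.IsRegular (T := A) (Set.range ρ)
  le_regular : IsRegularRel {w : Fin 2 → List A | ∃ x y : T, x ≤ y ∧ w = ![ρ x, ρ y]}

end WordAutomatic

/-! ### Partial-order trees and their Cantor-Bendixson rank -/

namespace PoTree

/-- `(T; ≤)` is a (partial-order) tree: there is a least element, and the predecessors of every
element form a finite linearly ordered set. -/
structure IsTree (T : Type*) [PartialOrder T] : Prop where
  exists_least : ∃ r : T, ∀ x : T, r ≤ x
  isChain_Iic : ∀ x : T, IsChain (· ≤ ·) (Set.Iic x)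
  finite_Iic : ∀ x : T, (Set.Iic x).Finite

universe u

variable {T : Type u} [PartialOrder T]

/-- `P` is an infinite path of the subtree with set of nodes `S`: an infinite, linearly ordered
subset of `S` which contains with every node all its predecessors in `S`. -/
structure IsInfinitePath (S P : Set T) : Prop where
  subset : P ⊆ S
  infinite : P.Infinite
  isChain : IsChain (· ≤ ·) P
  mem_of_le : ∀ x ∈ P, ∀ y ∈ S, y ≤ x → y ∈ P

/-- The derivative of the subtree with set of nodes `S`: the set of all nodes that belong to two
distinct infinite paths of it. -/
def derivative (S : Set T) : Set T :=
  {x | ∃ P Q : Set T, IsInfinitePath S P ∧ IsInfinitePath S Q ∧ P ≠ Q ∧ x ∈ P ∧ x ∈ Q}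

variable (T)

/-- The iterated derivative `d^α(T)`: `d^0(T) = T`, `d^(α+1)(T) = d(d^α(T))`, and
`d^γ(T) = ⋂_{β < γ} d^β(T)` for limit ordinals `γ`. -/
noncomputable def iterDerivative (α : Ordinal.{u}) : Set T :=
  Ordinal.limitRecOn α Set.univ (fun _ S => derivative S)
    (fun γ _ ih => ⋂ (β : Ordinal.{u}) (h : β < γ), ih β h)

/-- The Cantor-Bendixson rank of `T`: the least ordinal `α` with `d^α(T) = d^(α+1)(T)`
(such an ordinal exists, see `iterDerivative_cbRank`). -/
noncomputable def cbRank : Ordinal.{u} :=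
  sInf {α : Ordinal.{u} | iterDerivative T α = iterDerivative T (α + 1)}

theorem iterDerivative_zero : iterDerivative T 0 = Set.univ := by
  simp [iterDerivative]

theorem iterDerivative_add_one (α : Ordinal.{u}) :
    iterDerivative T (α + 1) = derivative (iterDerivative T α) := by
  simp [iterDerivative]

theorem iterDerivative_limit {γ : Ordinal.{u}} (h : Order.IsSuccLimit γ) :
    iterDerivative T γ = ⋂ (β : Ordinal.{u}) (_ : β < γ), iterDerivative T β := by
  simp only [iterDerivative]
  rw [Ordinal.limitRecOn_limit _ _ _ _ h]

theorem derivative_subset {T : Type u} [PartialOrder T] (S : Set T) : derivative S ⊆ S := by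
  rintro x ⟨P, Q, hP, -, -, hx, -⟩
  exact hP.subset hx

theorem iterDerivative_antitone : Antitone (iterDerivative T) := by
  intro α β hab
  induction β using Ordinal.limitRecOn with
  | zero => rw [nonpos_iff_eq_zero.mp hab]
  | add_one β ih =>
    rcases hab.lt_or_eq with h | h
    · rw [iterDerivative_add_one]
      exact (derivative_subset _).trans (ih (Order.lt_add_one_iff.mp h))
    · rw [h]
  | limit γ hγ ih =>
    rcases hab.lt_or_eq with h | h
    · rw [iterDerivative_limit T hγ]
      exact Set.iInter₂_subset α h
    · rw [h]

/-- The minimum in the definition of the Cantor-Bendixson rank is attained. -/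
theorem iterDerivative_cbRank :
    iterDerivative T (cbRank T) = iterDerivative T (cbRank T + 1) := by
  have hne : {α : Ordinal.{u} |
      iterDerivative T α = iterDerivative T (α + 1)}.Nonempty := by
    by_contra hno
    rw [Set.not_nonempty_iff_eq_empty, Set.eq_empty_iff_forall_notMem] at hno
    have key : ∀ α β : Ordinal.{u}, α < β → iterDerivative T α ≠ iterDerivative T β := by
      intro α β hlt heq
      refine hno α (Set.Subset.antisymm ?_ (iterDerivative_antitone T (Order.le_succ α : α ≤ α + 1)))
      rw [heq]
      exact iterDerivative_antitone T (Order.add_one_le_of_lt hlt)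
    refine not_injective_of_ordinal (iterDerivative T) fun α β h => ?_
    rcases lt_trichotomy α β with hlt | heq | hlt
    · exact absurd h (key α β hlt)
    · exact heq
    · exact absurd h.symm (key β α hlt)
  exact csInf_mem hne

end PoTree

/-! The nodes of finite derivatives are measured by `HasRank (cones T)`. If `x` lies on an infinite
path of the `n`-th derivative, its cone has rank at least `n + 1` (`hasRank_Ici_of_isInfinitePath`);
conversely, rank at least `n + 1` puts `x` in the `n`-th derivative
(`mem_iterDerivative_of_hasRank_Ici`). It therefore suffices to find one `m` such that every cone of
rank at least `m + 1` has rank at least `m + 2`.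

Automaticity provides it. Cut the cone of `x` according to the prefixes of length `|ρ x|` of names.
The rank is partition regular (`HasRank.exists_of_subset_iUnion`), so the piece at some prefix `w`
keeps the rank. After removal of `w`, this piece and the traces of all cones on it are described by
a left quotient and two sets of left quotients of the regular order language. By Myhill–Nerode only
finitely many such triples exist, so their ranks stabilize at a common `m` (`exists_stable`). No
bound on branching or on the number of paths is needed. -/

/-! ### A partition-regular rank of sets with respect to a family of sets -/

namespace CombRank

variable {α : Type*}

/-- `HasRank F n S`: the set `S` has rank at least `n` with respect to the family `F`. Rank at least
`n + 1` means that some decreasing sequence of members of `F` cuts `S` into pieces, infinitely many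
of which have rank at least `n`. -/
def HasRank (F : Set (Set α)) : ℕ → Set α → Prop
  | 0, S => S.Nonempty
  | n + 1, S => ∃ f : ℕ → Set α, (∀ i, f i ∈ F) ∧ Antitone f ∧
      ∀ i, HasRank F n (S ∩ (f i \ f (i + 1)))

theorem HasRank.mono {F : Set (Set α)} {n : ℕ} {S S' : Set α} (h : HasRank F n S)
    (hS : S ⊆ S') : HasRank F n S' := by
  induction n generalizing S S' with
  | zero => exact Set.Nonempty.mono hS h
  | succ n ih =>
    obtain ⟨f, hf, ha, h⟩ := h
    exact ⟨f, hf, ha, fun i => ih (h i) (Set.inter_subset_inter_left _ hS)⟩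

theorem HasRank.nonempty {F : Set (Set α)} {n : ℕ} {S : Set α} (h : HasRank F n S) :
    S.Nonempty := by
  induction n generalizing S with
  | zero => exact h
  | succ n ih =>
    obtain ⟨f, -, -, h⟩ := h
    exact (ih (h 0)).mono Set.inter_subset_left

theorem HasRank.pred {F : Set (Set α)} {n : ℕ} {S : Set α} (h : HasRank F (n + 1) S) :
    HasRank F n S := by
  induction n generalizing S with
  | zero => exact h.nonempty
  | succ n ih =>
    obtain ⟨f, hf, ha, h⟩ := h
    exact ⟨f, hf, ha, fun i => ih (h i)⟩

theorem not_hasRank_succ_of_subsingleton {F : Set (Set α)} {n : ℕ} {S : Set α}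
    (hS : S.Subsingleton) : ¬ HasRank F (n + 1) S := by
  rintro ⟨f, -, -, h⟩
  obtain ⟨a, ha, -, ha'⟩ := (h 0).nonempty
  obtain ⟨b, hb, hb', -⟩ := (h 1).nonempty
  exact ha' (hS hb ha ▸ hb')

/-- Pigeonhole: each of the infinitely many pieces keeps its rank inside some `P i`, and one `i`
serves infinitely many of them. -/
theorem HasRank.exists_of_subset_iUnion {F : Set (Set α)} {ι : Type*} [Finite ι] {n : ℕ}
    {S : Set α} (h : HasRank F n S) (P : ι → Set α) (hP : S ⊆ ⋃ i, P i) :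
    ∃ i, HasRank F n (S ∩ P i) := by
  induction n generalizing S with
  | zero =>
    obtain ⟨a, ha⟩ := h
    obtain ⟨i, hi⟩ := Set.mem_iUnion.mp (hP ha)
    exact ⟨i, a, ha, hi⟩
  | succ n ih =>
    obtain ⟨f, hf, ha, h⟩ := h
    choose c hc using fun j => ih (h j) (Set.inter_subset_left.trans hP)
    obtain ⟨i, hi⟩ := Finite.exists_infinite_fiber c
    classical
    let e := Nat.orderEmbeddingOfSet (c ⁻¹' {i})
    have he : ∀ k, c (e k) = i := fun k => (Nat.Subtype.ofNat (c ⁻¹' {i}) k).2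
    -- Passing to a subsequence of a decreasing sequence only enlarges the retained pieces.
    refine ⟨i, fun k => f (e k), fun k => hf _, fun k l hkl => ha (e.monotone hkl),
      fun k => (hc (e k)).mono ?_⟩
    rintro a ⟨⟨haS, ha1, ha2⟩, haP⟩
    exact ⟨⟨haS, he k ▸ haP⟩, ha1, fun h' => ha2 (ha (e.strictMono k.lt_succ_self) h')⟩

/-- Since the rank conditions become stronger, each of finitely many sets eventually satisfies all
or none of them. -/
theorem exists_stable {ι : Type*} (s : Set ι) (hs : s.Finite) (p : ι → ℕ → Prop)
    (hp : ∀ i n, p i (n + 1) → p i n) : ∃ m, ∀ i ∈ s, p i m → p i (m + 1) := by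
  have hle : ∀ i m n, m ≤ n → p i n → p i m := fun i m n hmn => by
    induction hmn with
    | refl => exact id
    | step _ ih => exact fun h => ih (hp _ _ h)
  have hex : ∀ i, ∃ m, ∀ n ≥ m, p i n → p i (n + 1) := fun i => by
    by_cases h : ∀ n, p i n
    · exact ⟨0, fun n _ _ => h _⟩
    · obtain ⟨m, hm⟩ := not_forall.mp h
      exact ⟨m, fun n hn hpn => absurd (hle i m n hn hpn) hm⟩
  choose g hg using hex
  obtain ⟨m, hm⟩ := (hs.image g).bddAbove
  exact ⟨m, fun i hi => hg i m (hm ⟨i, hi, rfl⟩)⟩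

end CombRank

/-! ### The derivatives of a tree and the rank of its cones -/

namespace PoTree

open CombRank

variable {T : Type*} [PartialOrder T]

/-- The family of the cones of a partial order. -/
def cones (T : Type*) [PartialOrder T] : Set (Set T) := Set.range Set.Ici

theorem isLowerSet_derivative {S : Set T} (hS : IsLowerSet S) : IsLowerSet (derivative S) := by
  rintro x y hyx ⟨P, Q, hP, hQ, hne, hxP, hxQ⟩
  have hy : y ∈ S := hS hyx (hP.subset hxP)
  exact ⟨P, Q, hP, hQ, hne, hP.mem_of_le x hxP y hy hyx, hQ.mem_of_le x hxQ y hy hyx⟩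

theorem iterDerivative_natCast_succ (n : ℕ) :
    iterDerivative T ((n + 1 : ℕ) : Ordinal) = derivative (iterDerivative T n) := by
  rw [Nat.cast_succ, iterDerivative_add_one]

theorem isLowerSet_iterDerivative_natCast (n : ℕ) :
    IsLowerSet (iterDerivative T (n : Ordinal)) := by
  induction n with
  | zero => rw [Nat.cast_zero, iterDerivative_zero]; exact isLowerSet_univ
  | succ n ih => rw [iterDerivative_natCast_succ]; exact isLowerSet_derivative ih

theorem IsInfinitePath.isLowerSet {S P : Set T} (hP : IsInfinitePath S P) (hS : IsLowerSet S) :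
    IsLowerSet P :=
  fun x y hyx hx => hP.mem_of_le x hx y (hS hyx (hP.subset hx)) hyx

theorem _root_.CombRank.HasRank.exists_strictMono {n : ℕ} {S : Set T}
    (h : HasRank (cones T) (n + 1) S) : ∃ y : ℕ → T, StrictMono y ∧
      ∀ i, HasRank (cones T) n (S ∩ (Set.Ici (y i) \ Set.Ici (y (i + 1)))) := by
  obtain ⟨f, hf, ha, h⟩ := h
  choose y hy using hf
  obtain rfl : (fun i => Set.Ici (y i)) = f := funext hy
  refine ⟨y, strictMono_nat_of_lt_succ fun i => ?_, h⟩
  refine lt_of_le_of_ne (ha i.le_succ Set.self_mem_Ici) fun e => ?_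
  obtain ⟨t, -, ht, ht'⟩ := (h i).nonempty
  exact ht' (e.symm.trans_le ht)

/-- Iterating `p ↦ q` from `x` gives the decreasing sequence of cones. -/
theorem hasRank_succ_of_forall_exists {P : Set T} {n : ℕ}
    (h : ∀ p ∈ P, ∃ q ∈ P, p ≤ q ∧ HasRank (cones T) n (Set.Ici p \ Set.Ici q)) {x : T}
    (hx : x ∈ P) : HasRank (cones T) (n + 1) (Set.Ici x) := by
  choose! g hgP hle hg using h
  have hmem : ∀ i, g^[i] x ∈ P := fun i => by
    induction i with
    | zero => exact hx
    | succ i ih => rw [Function.iterate_succ_apply']; exact hgP _ ih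
  have hmono : Monotone fun i => g^[i] x := monotone_nat_of_le_succ fun i => by
    rw [Function.iterate_succ_apply']; exact hle _ (hmem i)
  refine ⟨fun i => Set.Ici (g^[i] x), fun i => ⟨_, rfl⟩,
    fun i j hij => Set.Ici_subset_Ici.mpr (hmono hij), fun i => ?_⟩
  simp only [Function.iterate_succ_apply']
  exact (hg _ (hmem i)).mono fun t ht => ⟨(hmono (Nat.zero_le i)).trans ht.1, ht⟩

namespace IsTree

variable (hT : IsTree T)
include hT

theorem le_or_le {x y z : T} (hx : x ≤ z) (hy : y ≤ z) : x ≤ y ∨ y ≤ x :=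
  (hT.isChain_Iic z).total hx hy

theorem exists_mem_not_le {P : Set T} (hP : P.Infinite) (x : T) : ∃ q ∈ P, ¬ q ≤ x := by
  by_contra! h
  exact hP ((hT.finite_Iic x).subset h)

theorem exists_mem_lt_not_le {S P : Set T} (hP : IsInfinitePath S P) {p z : T} (hp : p ∈ P)
    (hpz : p ≤ z) : ∃ q ∈ P, p < q ∧ ¬ q ≤ z := by
  obtain ⟨q, hq, hqz⟩ := hT.exists_mem_not_le hP.infinite z
  refine ⟨q, hq, ?_, hqz⟩
  rcases hP.isChain.total hp hq with h | h
  · exact lt_of_le_of_ne h fun e => hqz (e ▸ hpz)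
  · exact absurd (h.trans hpz) hqz

theorem isInfinitePath_of_strictMono {S : Set T} (hS : IsLowerSet S) {y : ℕ → T}
    (hy : StrictMono y) (hyS : ∀ i, y i ∈ S) : IsInfinitePath S {p | ∃ i, p ≤ y i} where
  subset := fun _ ⟨i, hi⟩ => hS hi (hyS i)
  infinite := (Set.infinite_range_of_injective hy.injective).mono
    (by rintro _ ⟨i, rfl⟩; exact ⟨i, le_rfl⟩)
  isChain := by
    rintro p ⟨i, hi⟩ q ⟨j, hj⟩ -
    exact hT.le_or_le (hi.trans (hy.monotone (le_max_left i j)))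
      (hj.trans (hy.monotone (le_max_right i j)))
  mem_of_le := fun _ ⟨i, hi⟩ _ _ h => ⟨i, h.trans hi⟩

theorem eq_of_isInfinitePath_of_subset {S P Q : Set T} (hS : IsLowerSet S)
    (hP : IsInfinitePath S P) (hQ : IsInfinitePath S Q) (h : Q ⊆ P) : Q = P := by
  refine h.antisymm fun p hp => ?_
  obtain ⟨q, hq, hqp⟩ := hT.exists_mem_not_le hQ.infinite p
  exact hQ.isLowerSet hS ((hP.isChain.total hp (h hq)).resolve_right hqp) hq

/-- Every `p` on `P` also lies on another path `Q` of the preceding derivative. Choose `z` on `Q`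
off `P`, then `q` on `P` not below `z`: the cones of `z` and `q` are disjoint, so the cone of `z`,
of large rank by induction, lies in the piece between `p` and `q`. -/
theorem hasRank_Ici_of_isInfinitePath (n : ℕ) {P : Set T}
    (hP : IsInfinitePath (iterDerivative T (n : Ordinal)) P) {x : T} (hx : x ∈ P) :
    HasRank (cones T) (n + 1) (Set.Ici x) := by
  induction n generalizing P x with
  | zero =>
    refine hasRank_succ_of_forall_exists (P := P) (fun p hp => ?_) hx
    obtain ⟨q, hq, hpq, hqp⟩ := hT.exists_mem_lt_not_le hP hp le_rfl
    exact ⟨q, hq, hpq.le, p, le_rfl, hqp⟩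
  | succ n ih =>
    have hL := isLowerSet_iterDerivative_natCast (T := T) n
    have hP' := hP.isLowerSet (isLowerSet_iterDerivative_natCast (n + 1))
    rw [iterDerivative_natCast_succ] at hP
    have hPn : IsInfinitePath (iterDerivative T (n : Ordinal)) P :=
      ⟨hP.subset.trans (derivative_subset _), hP.infinite, hP.isChain,
        fun x hx y _ hyx => hP' hyx hx⟩
    refine hasRank_succ_of_forall_exists (P := P) (fun p hp => ?_) hx
    obtain ⟨Q, hQ, hne, hpQ⟩ : ∃ Q, IsInfinitePath (iterDerivative T (n : Ordinal)) Q ∧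
        Q ≠ P ∧ p ∈ Q := by
      obtain ⟨Q, R, hQ, hR, hQR, hpQ, hpR⟩ := hP.subset hp
      by_cases h : Q = P
      · exact ⟨R, hR, fun h' => hQR (h.trans h'.symm), hpR⟩
      · exact ⟨Q, hQ, h, hpQ⟩
    obtain ⟨z, hzQ, hzP⟩ := Set.not_subset.mp fun h =>
      hne (hT.eq_of_isInfinitePath_of_subset hL hPn hQ h)
    have hpz : p ≤ z := (hQ.isChain.total hpQ hzQ).resolve_right fun h => hzP (hP' h hp)
    obtain ⟨q, hq, hpq, hqz⟩ := hT.exists_mem_lt_not_le hPn hp hpz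
    refine ⟨q, hq, hpq.le, (ih hQ hzQ).mono fun t ht => ⟨hpz.trans ht, fun htq => ?_⟩⟩
    rcases hT.le_or_le htq ht with h | h
    · exact hqz h
    · exact hzP (hP' h hq)

/-- A general `S` is needed because the induction is applied to differences of cones. The path `P i`
obtained from the `i`-th piece stays below elements of that piece, hence contains `y i` but not `y
(i + 1)`. So `P i` and `P (i + 1)` are distinct paths through `y i`. -/
theorem exists_isInfinitePath_of_hasRank (n : ℕ) {S : Set T}
    (h : HasRank (cones T) (n + 1) S) :
    ∃ P, IsInfinitePath (iterDerivative T (n : Ordinal)) P ∧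
      ∀ p ∈ P, (S ∩ Set.Ici p).Nonempty := by
  induction n generalizing S with
  | zero =>
    obtain ⟨y, hmono, h⟩ := h.exists_strictMono
    refine ⟨_, hT.isInfinitePath_of_strictMono (isLowerSet_iterDerivative_natCast 0) hmono
      fun i => by simp [iterDerivative_zero], ?_⟩
    rintro p ⟨i, hi⟩
    obtain ⟨t, htS, ht, -⟩ := (h i).nonempty
    exact ⟨t, htS, hi.trans ht⟩
  | succ n ih =>
    obtain ⟨y, hmono, h⟩ := h.exists_strictMono
    have hL := isLowerSet_iterDerivative_natCast (T := T) n
    choose P hP hPS using fun i => ih (h i)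
    have hmem : ∀ i, y i ∈ P i := fun i => by
      obtain ⟨p, hp, hpy⟩ := hT.exists_mem_not_le (hP i).infinite (y i)
      obtain ⟨t, ⟨-, ht, -⟩, htp⟩ := hPS i p hp
      exact (hP i).isLowerSet hL ((hT.le_or_le htp ht).resolve_left hpy) hp
    have hnot : ∀ i, y (i + 1) ∉ P i := fun i hi => by
      obtain ⟨t, ⟨-, -, ht⟩, ht'⟩ := hPS i _ hi
      exact ht ht'
    refine ⟨_, hT.isInfinitePath_of_strictMono (isLowerSet_iterDerivative_natCast (n + 1)) hmono
      fun i => ?_, ?_⟩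
    · rw [iterDerivative_natCast_succ]
      exact ⟨P i, P (i + 1), hP i, hP (i + 1), fun e => hnot i (e ▸ hmem (i + 1)), hmem i,
        (hP (i + 1)).isLowerSet hL (hmono i.lt_succ_self).le (hmem (i + 1))⟩
    · rintro p ⟨i, hi⟩
      obtain ⟨t, htS, ht, -⟩ := (h i).nonempty
      exact ⟨t, htS, hi.trans ht⟩

theorem mem_iterDerivative_of_hasRank_Ici (n : ℕ) {x : T}
    (h : HasRank (cones T) (n + 1) (Set.Ici x)) : x ∈ iterDerivative T (n : Ordinal) := by
  obtain ⟨P, hP, hPx⟩ := hT.exists_isInfinitePath_of_hasRank n h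
  obtain ⟨p, hp, hpx⟩ := hT.exists_mem_not_le hP.infinite x
  obtain ⟨t, ht, ht'⟩ := hPx p hp
  exact isLowerSet_iterDerivative_natCast n ((hT.le_or_le ht' ht).resolve_left hpx) (hP.subset hp)

/-- Under `h`, every infinite path of the `m`-th derivative already lies in the next one, so
deriving once more loses nothing and the rank is at most `m + 1`. -/
theorem cbRank_eq_natCast_of_hasRank (m : ℕ)
    (h : ∀ x : T, HasRank (cones T) (m + 1) (Set.Ici x) →
      HasRank (cones T) (m + 2) (Set.Ici x)) :
    ∃ n : ℕ, cbRank T = (n : Ordinal) := by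
  have hsub : iterDerivative T ((m + 1 : ℕ) : Ordinal) ⊆
      iterDerivative T ((m + 1 + 1 : ℕ) : Ordinal) := by
    have hpath : ∀ P, IsInfinitePath (iterDerivative T (m : Ordinal)) P →
        IsInfinitePath (iterDerivative T ((m + 1 : ℕ) : Ordinal)) P := fun P hP =>
      ⟨fun p hp => hT.mem_iterDerivative_of_hasRank_Ici (m + 1)
        (h p (hT.hasRank_Ici_of_isInfinitePath m hP hp)), hP.infinite, hP.isChain,
        fun x hx y _ hyx => hP.isLowerSet (isLowerSet_iterDerivative_natCast m) hyx hx⟩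
    rw [iterDerivative_natCast_succ (m + 1), iterDerivative_natCast_succ m]
    rintro x ⟨P, Q, hP, hQ, hx⟩
    rw [← iterDerivative_natCast_succ m]
    exact ⟨P, Q, hpath P hP, hpath Q hQ, hx⟩
  have hle : cbRank T ≤ ((m + 1 : ℕ) : Ordinal) := csInf_le' <| by
    refine hsub.antisymm ?_ |>.trans ?_
    · rw [iterDerivative_natCast_succ (m + 1)]
      exact derivative_subset _
    · rw [Nat.cast_succ (m + 1)]
  exact Ordinal.lt_omega0.mp (hle.trans_lt (Ordinal.natCast_lt_omega0 _))

end IsTree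

end PoTree

/-! ### Convolutions of two words -/

namespace WordAutomatic

open CombRank PoTree

variable {A : Type*}

theorem convolution_pair (u v : List A) :
    convolution ![u, v] =
      (List.range (max u.length v.length)).map fun j => ![u[j]?, v[j]?] := by
  have : (Finset.univ.sup fun i : Fin 2 => (![u, v] i).length) = max u.length v.length := by
    simp [Fin.univ_succ]
  rw [convolution, this]
  refine List.map_congr_left fun j _ => funext fun i => ?_
  fin_cases i <;> rfl

theorem getElem?_convolution_pair (u v : List A) (j : ℕ) :
    (convolution ![u, v])[j]? =
      if j < max u.length v.length then some ![u[j]?, v[j]?] else none := by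
  rw [convolution_pair]
  split_ifs with h <;> simp_all

theorem convolution_pair_injective {u v u' v' : List A}
    (h : convolution ![u, v] = convolution ![u', v']) : u = u' ∧ v = v' := by
  have hlen : max u.length v.length = max u'.length v'.length := by
    simpa [convolution_pair] using congrArg List.length h
  have key : ∀ j : ℕ, u[j]? = u'[j]? ∧ v[j]? = v'[j]? := fun j => by
    have hj := congrArg (fun l => l[j]?) h
    simp only [getElem?_convolution_pair, hlen] at hj
    split_ifs at hj with hlt
    · have hj := Option.some.inj hj
      exact ⟨congrFun hj 0, congrFun hj 1⟩
    · have h1 : max u.length v.length ≤ j := hlen ▸ not_lt.mp hlt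
      have h2 := not_lt.mp hlt
      simp only [max_le_iff] at h1 h2
      simp [h1, h2]
  exact ⟨List.ext_getElem? fun j => (key j).1, List.ext_getElem? fun j => (key j).2⟩

/-- The part of the convolution of `u` with a word extending `w` that is read along `w`. -/
def convolutionPrefix (u w : List A) : List (Fin 2 → Option A) :=
  (List.range w.length).map fun j => ![u[j]?, w[j]?]

theorem convolution_append (u w v : List A) :
    convolution ![u, w ++ v] =
      convolutionPrefix u w ++ convolution ![u.drop w.length, v] := by
  have hmax : max u.length (w ++ v).length = w.length + max (u.length - w.length) v.length := by
    rw [List.length_append]; omega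
  rw [convolution_pair, convolution_pair, convolutionPrefix, hmax, List.range_add,
    List.map_append, List.map_map, List.length_drop]
  congr 1
  · refine List.map_congr_left fun j hj => ?_
    rw [List.getElem?_append_left (List.mem_range.mp hj)]
  · refine List.map_congr_left fun j _ => ?_
    simp [List.getElem?_append_right, List.getElem?_drop]

/-! ### The trace of a tree on the words with a given prefix -/

section Trace

variable {T : Type*} (ρ : T → List A)

/-- The words `v` such that `w ++ v` names an element of `S`. -/
def trace (w : List A) (S : Set T) : Set (List A) := {v | ∃ t ∈ S, ρ t = w ++ v}

theorem trace_inter_diff (hρ : Function.Injective ρ) (w : List A) (S F G : Set T) :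
    trace ρ w (S ∩ (F \ G)) = trace ρ w S ∩ (trace ρ w F \ trace ρ w G) := by
  ext v
  constructor
  · rintro ⟨t, ⟨hS, hF, hG⟩, ht⟩
    refine ⟨⟨t, hS, ht⟩, ⟨t, hF, ht⟩, ?_⟩
    rintro ⟨t', hG', ht'⟩
    exact hG (hρ (ht.trans ht'.symm) ▸ hG')
  · rintro ⟨⟨t, hS, ht⟩, ⟨t', hF, ht'⟩, hG⟩
    obtain rfl := hρ (ht.trans ht'.symm)
    exact ⟨t, ⟨hS, hF, fun h => hG ⟨t, h, ht⟩⟩, ht⟩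

variable {ρ} [PartialOrder T]

theorem hasRank_trace {w : List A} (hρ : Function.Injective ρ) {F : Set (Set (List A))}
    (hF : ∀ y : T, trace ρ w (Set.Ici y) ∈ F) {n : ℕ} {S : Set T}
    (hS : ∀ t ∈ S, ∃ v, ρ t = w ++ v) (h : HasRank (cones T) n S) :
    HasRank F n (trace ρ w S) := by
  induction n generalizing S with
  | zero =>
    obtain ⟨t, ht⟩ := h
    obtain ⟨v, hv⟩ := hS t ht
    exact ⟨v, t, ht, hv⟩
  | succ n ih =>
    obtain ⟨f, hf, ha, h⟩ := h
    refine ⟨fun i => trace ρ w (f i), fun i => ?_, ?_, fun i => ?_⟩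
    · obtain ⟨y, hy⟩ := hf i
      simpa only [← hy] using hF y
    · rintro i j hij v ⟨t, ht, htv⟩
      exact ⟨t, ha hij ht, htv⟩
    · rw [← trace_inter_diff ρ hρ]
      exact ih (fun t ht => hS t ht.1) (h i)

/-- The pieces are nonempty, so all members of the sequence are, and each is the trace of a cone; it
remains to see that the cones themselves decrease. -/
theorem hasRank_of_hasRank_trace (hT : IsTree T) {w : List A} (hρ : Function.Injective ρ)
    {F : Set (Set (List A))}
    (hF : ∀ G ∈ F, G.Nonempty → ∃ y : T, G = trace ρ w (Set.Ici y)) {n : ℕ} {S : Set T}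
    (h : HasRank F n (trace ρ w S)) : HasRank (cones T) n S := by
  induction n generalizing S with
  | zero =>
    obtain ⟨v, t, ht, -⟩ := h
    exact ⟨t, ht⟩
  | succ n ih =>
    obtain ⟨f, hf, ha, h⟩ := h
    have hne : ∀ i, (f i).Nonempty := fun i =>
      (h i).nonempty.mono fun v hv => hv.2.1
    choose y hy using fun i => hF (f i) (hf i) (hne i)
    have hmono : Monotone y := monotone_nat_of_le_succ fun i => by
      obtain ⟨v, hv⟩ := hne (i + 1)
      have hv' := ha i.le_succ hv
      rw [hy] at hv hv'
      obtain ⟨t, ht, htv⟩ := hv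
      obtain ⟨t', ht', htv'⟩ := hv'
      obtain rfl := hρ (htv.trans htv'.symm)
      -- Nested nonempty traces give a common upper bound, so the two roots are comparable; the
      -- wrong order would empty the piece.
      refine (hT.le_or_le ht' ht).resolve_right fun hle => ?_
      obtain ⟨u, -, hu, hu'⟩ := (h i).nonempty
      rw [hy] at hu hu'
      obtain ⟨s, hs, hsu⟩ := hu
      exact hu' ⟨s, hle.trans hs, hsu⟩
    refine ⟨fun i => Set.Ici (y i), fun i => ⟨_, rfl⟩,
      fun i j hij => Set.Ici_subset_Ici.mpr (hmono hij), fun i => ih ?_⟩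
    rw [trace_inter_diff ρ hρ, ← hy, ← hy]
    exact h i

end Trace

/-! ### Finitely many types of traces -/

/-- The words `v` whose convolution with `u` belongs to `K`. -/
def rightSection (K : Language (Fin 2 → Option A)) (u : List A) : Set (List A) :=
  {v | convolution ![u, v] ∈ K}

/-- The family of all sections of members of `𝒦`, together with the sections at the empty word of
members of `𝒦₀`. -/
def sectionFamily (𝒦₀ 𝒦 : Set (Language (Fin 2 → Option A))) : Set (Set (List A)) :=
  {G | (∃ K ∈ 𝒦₀, G = rightSection K []) ∨ ∃ K ∈ 𝒦, ∃ u, G = rightSection K u}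

variable {T : Type*} [PartialOrder T] {ρ : T → List A}

/-- The convolutions of the pairs of names of comparable elements. -/
def leLanguage (ρ : T → List A) : Language (Fin 2 → Option A) :=
  convolution '' {w : Fin 2 → List A | ∃ x y : T, x ≤ y ∧ w = ![ρ x, ρ y]}

theorem convolution_mem_leLanguage {u v : List A} :
    convolution ![u, v] ∈ leLanguage ρ ↔ ∃ x y : T, x ≤ y ∧ ρ x = u ∧ ρ y = v := by
  constructor
  · rintro ⟨_, ⟨x, y, hxy, rfl⟩, h⟩
    exact ⟨x, y, hxy, convolution_pair_injective h⟩
  · rintro ⟨x, y, hxy, rfl, rfl⟩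
    exact ⟨_, ⟨x, y, hxy, rfl⟩, rfl⟩

/-- The left quotient of the order language that remains to be checked after reading `u` along
`w`. -/
def leQuotient (ρ : T → List A) (w u : List A) : Language (Fin 2 → Option A) :=
  (leLanguage ρ).leftQuotient (convolutionPrefix u w)

theorem mem_rightSection_leQuotient {w u v : List A} :
    v ∈ rightSection (leQuotient ρ w u) (u.drop w.length) ↔
      ∃ x y : T, x ≤ y ∧ ρ x = u ∧ ρ y = w ++ v := by
  rw [← convolution_mem_leLanguage, convolution_append]
  rfl

theorem rightSection_leQuotient (hρ : Function.Injective ρ) (w : List A) (y : T) :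
    rightSection (leQuotient ρ w (ρ y)) ((ρ y).drop w.length) = trace ρ w (Set.Ici y) := by
  ext v
  rw [mem_rightSection_leQuotient]
  constructor
  · rintro ⟨x, t, hxt, hx, ht⟩
    exact ⟨t, hρ hx ▸ hxt, ht⟩
  · rintro ⟨t, hyt, ht⟩
    exact ⟨y, t, hyt, rfl, ht⟩

theorem exists_eq_trace_of_nonempty (hρ : Function.Injective ρ) {w u : List A}
    (h : (rightSection (leQuotient ρ w u) (u.drop w.length)).Nonempty) :
    ∃ y : T, rightSection (leQuotient ρ w u) (u.drop w.length) = trace ρ w (Set.Ici y) := by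
  obtain ⟨v, hv⟩ := h
  obtain ⟨x, -, -, rfl, -⟩ := mem_rightSection_leQuotient.mp hv
  exact ⟨x, rightSection_leQuotient hρ w x⟩

theorem convolutionPrefix_append_left {u w : List A} (h : w.length ≤ u.length) (b : List A) :
    convolutionPrefix (u ++ b) w = convolutionPrefix u w := by
  refine List.map_congr_left fun j hj => ?_
  rw [List.getElem?_append_left ((List.mem_range.mp hj).trans_le h)]

/-- The family of the traces on the words with prefix `w`, described by left quotients. -/
def traceFamily (ρ : T → List A) (w : List A) : Set (Set (List A)) :=
  sectionFamily (leQuotient ρ w '' {u | u.length ≤ w.length})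
    (leQuotient ρ w '' {u | u.length = w.length})

/-- A name no longer than `w` is used up while `w` is read; of a longer one, only the first `|w|`
letters affect the quotient, and the rest is the section parameter. -/
theorem trace_mem_traceFamily (hρ : Function.Injective ρ) (w : List A) (y : T) :
    trace ρ w (Set.Ici y) ∈ traceFamily ρ w := by
  rw [← rightSection_leQuotient hρ]
  rcases le_total (ρ y).length w.length with h | h
  · refine Or.inl ⟨_, ⟨ρ y, h, rfl⟩, ?_⟩
    rw [List.drop_eq_nil_of_le h]
  · refine Or.inr ⟨_, ⟨(ρ y).take w.length, by simpa using h, rfl⟩, (ρ y).drop w.length, ?_⟩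
    rw [leQuotient, leQuotient, ← convolutionPrefix_append_left (u := (ρ y).take w.length)
      (by simpa using h) ((ρ y).drop w.length), List.take_append_drop]

/-- The section parameter `b` ranges over all words, so `u ++ b` need not be a name; a nonempty
section forces it to be one. -/
theorem exists_eq_trace_of_mem_traceFamily (hρ : Function.Injective ρ) {w : List A}
    {G : Set (List A)} (hG : G ∈ traceFamily ρ w) (hne : G.Nonempty) :
    ∃ y : T, G = trace ρ w (Set.Ici y) := by
  rcases hG with ⟨_, ⟨u, hu, rfl⟩, rfl⟩ | ⟨_, ⟨u, hu, rfl⟩, b, rfl⟩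
  · have hd : u.drop w.length = [] := List.drop_eq_nil_of_le hu
    rw [← hd] at hne ⊢
    exact exists_eq_trace_of_nonempty hρ hne
  · have hd : (u ++ b).drop w.length = b := by
      rw [← (hu : u.length = w.length), List.drop_left]
    have hK : leQuotient ρ w u = leQuotient ρ w (u ++ b) := by
      rw [leQuotient, leQuotient, convolutionPrefix_append_left (le_of_eq hu.symm)]
    have hs : rightSection (leQuotient ρ w u) b =
        rightSection (leQuotient ρ w (u ++ b)) ((u ++ b).drop w.length) := by rw [hK, hd]
    rw [hs] at hne ⊢
    exact exists_eq_trace_of_nonempty hρ hne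

theorem IsPresentation.exists_hasRank_succ [Finite A] (hT : IsTree T) (hρ : IsPresentation ρ) :
    ∃ m : ℕ, ∀ x : T, HasRank (cones T) (m + 1) (Set.Ici x) →
      HasRank (cones T) (m + 2) (Set.Ici x) := by
  have hfin : (Set.range (leLanguage ρ).leftQuotient).Finite :=
    Language.IsRegular.finite_range_leftQuotient hρ.le_regular
  set 𝒬 := Set.range (leLanguage ρ).leftQuotient
  have hmem : ∀ w u, leQuotient ρ w u ∈ 𝒬 := fun w u => ⟨_, rfl⟩
  have himg : ∀ w (s : Set (List A)), leQuotient ρ w '' s ∈ 𝒬.powerset := by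
    rintro w s _ ⟨u, -, rfl⟩
    exact hmem w u
  -- A triple records the two sets of quotients defining the family and the quotient defining the
  -- trace of the cone.
  obtain ⟨m, hm⟩ := exists_stable (𝒬.powerset ×ˢ 𝒬.powerset ×ˢ 𝒬)
    (hfin.powerset.prod (hfin.powerset.prod hfin))
    (fun τ n => HasRank (sectionFamily τ.1 τ.2.1) (n + 1) (rightSection τ.2.2 []))
    (fun τ n h => h.pred)
  refine ⟨m, fun x hx => ?_⟩
  have := (List.finite_length_le A (ρ x).length).to_subtype
  obtain ⟨⟨w, hw⟩, h⟩ := hx.exists_of_subset_iUnion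
    (fun w : {w : List A | w.length ≤ (ρ x).length} => {t | (ρ t).take (ρ x).length = w})
    fun t _ => Set.mem_iUnion.mpr ⟨⟨(ρ t).take (ρ x).length, by simp⟩, rfl⟩
  rcases (show w.length ≤ (ρ x).length from hw).lt_or_eq with hlt | heq
  · refine absurd h (not_hasRank_succ_of_subsingleton ?_)
    have hw' : ∀ t, (ρ t).take (ρ x).length = w → ρ t = w := fun t ht => by
      have := congrArg List.length ht
      rw [List.length_take] at this
      rw [← ht, List.take_of_length_le (by omega)]
    rintro s ⟨-, hs⟩ t ⟨-, ht⟩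
    exact hρ.injective ((hw' s hs).trans (hw' t ht).symm)
  · have hsec : rightSection (leQuotient ρ w (ρ x)) [] = trace ρ w (Set.Ici x) := by
      rw [← rightSection_leQuotient hρ.injective, heq, List.drop_length]
    have h1 : HasRank (traceFamily ρ w) (m + 1) (trace ρ w (Set.Ici x)) := by
      refine (hasRank_trace hρ.injective (trace_mem_traceFamily hρ.injective w)
        (fun t ht => ⟨(ρ t).drop (ρ x).length, ?_⟩) h).mono ?_
      · rw [← (show (ρ t).take (ρ x).length = w from ht.2), List.take_append_drop]
      · rintro v ⟨t, ht, htv⟩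
        exact ⟨t, ht.1, htv⟩
    rw [← hsec] at h1
    have h2 : HasRank (traceFamily ρ w) (m + 2) (rightSection (leQuotient ρ w (ρ x)) []) :=
      hm (leQuotient ρ w '' {u | u.length ≤ w.length},
        leQuotient ρ w '' {u | u.length = w.length}, leQuotient ρ w (ρ x))
        ⟨himg w _, himg w _, hmem w (ρ x)⟩ h1
    rw [hsec] at h2
    exact hasRank_of_hasRank_trace hT hρ.injective
      (fun G hG => exists_eq_trace_of_mem_traceFamily hρ.injective hG) h2

end WordAutomatic

theorem mainTheorem9 {A : Type*} [Finite A] {T : Type*} [PartialOrder T]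
    (hT : PoTree.IsTree T) (ρ : T → List A) (hρ : WordAutomatic.IsPresentation ρ) :
    ∃ n : ℕ, PoTree.cbRank T = (n : Ordinal) := by
  obtain ⟨m, hm⟩ := hρ.exists_hasRank_succ hT
  exact hT.cbRank_eq_natCast_of_hasRank m hm
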